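/- Let $M$ be a smooth Riemannian manifold of dimension $m\ge 2$ (completeness is not needed), with Levi-Civita connection $\nabla$, let $p>1$ be real, and let $u\in C^2(M)$ be a $p$-harmonic function, i.e. $\Delta_p u:=\operatorname{div}\left(|\nabla u|^{p-2}\nabla u\right)=0$ at every point where $du\ne 0$. Put $$\kappa=\min\left\{\frac{(p-1)^2}{m-1},\,1\right\}.$$ Then at every point $x\in M$ with $du(x)\neq 0$, $$|\nabla du|^2\ \ge\ (1+\kappa)\,\bigl|\nabla |du|\bigr|^2 ,$$ where $\nabla du$ is the Hessian of $u$. Moreover, let $e_1,\dots,e_m$ be any orthonormal basis of $T_xM$ with $\nabla u(x)=|\nabla u(x)|\,e_1$, and write $u_{ij}=(\nabla du)(e_i,e_j)$. Then equality holds at $x$ if and only if, for all $\alpha,\beta\in\{2,\dots,m\}$ with $\alpha\ne\beta$ and all $i\in\{1,\dots,m\}$ (each condition being required for all values of the indices that occur in it), $$\begin{cases} u_{\alpha\beta}=0\ \text{ and }\ u_{11}=-\dfrac{m-1}{p-1}\,u_{\alpha\alpha}, & \text{if } (p-1)^2=m-1,\\[1ex] u_{\alpha\beta}=0,\ \ u_{1\alpha}=0\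 \text{ and }\ u_{11}=-\dfrac{m-1}{p-1}\,u_{\alpha\alpha}, & \text{if } (p-1)^2<m-1,\\[1ex] u_{\alpha\beta}=0\ \text{ and }\ u_{ii}=0, & \text{if } (p-1)^2>m-1. \end{cases}$$ -/

import Mathlib

open Bundle VectorField
open scoped Manifold ContDiff

noncomputable section

namespace RiemKato

section General

variable {E : Type*} [NormedAddCommGroup E] [NormedSpace ℝ E]
  {H : Type*} [TopologicalSpace H] (I : ModelWithCorners ℝ E H)
  {M : Type*} [TopologicalSpace M] [ChartedSpace H M]
  [RiemannianBundle (fun (x : M) ↦ TangentSpace I x)]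

/-- The right-hand side of the Koszul formula
`2⟨∇_V S, W⟩ = V⟨S, W⟩ + S⟨V, W⟩ - W⟨V, S⟩ + ⟨[V, S], W⟩ - ⟨[S, W], V⟩ - ⟨[V, W], S⟩`
at the point `x`, divided by two. -/
def koszul (S V W : Π x : M, TangentSpace I x) (x : M) : ℝ :=
  2⁻¹ * (mvfderiv I (fun y ↦ inner ℝ (S y) (W y)) x (V x)
    + mvfderiv I (fun y ↦ inner ℝ (V y) (W y)) x (S x)
    - mvfderiv I (fun y ↦ inner ℝ (V y) (S y)) x (W x)
    + inner ℝ (mlieBracket I V S x) (W x)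
    - inner ℝ (mlieBracket I S W x) (V x)
    - inner ℝ (mlieBracket I V W x) (S x))

variable [FiniteDimensional ℝ E] [IsManifold I ∞ M]
  [IsContMDiffRiemannianBundle I ∞ E (fun (x : M) ↦ TangentSpace I x)]

variable {I}

theorem mdifferentiableAt_inner {V W : Π x : M, TangentSpace I x} {x : M}
    (hV : MDiffAt (T% V) x) (hW : MDiffAt (T% W) x) :
    MDiffAt (fun y ↦ (inner ℝ (V y) (W y) : ℝ)) x :=
  MDifferentiableAt.inner_bundle (E := fun x : M ↦ TangentSpace I x) hV hW

theorem koszul_tensorial_left {S W : Π x : M, TangentSpace I x} {x : M}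
    (hS : MDiffAt (T% S) x) (hW : MDiffAt (T% W) x) :
    TensorialAt I E (fun V ↦ koszul I S V W x) x where
  smul {f V} hf hV := by
    have h1 : (fun y ↦ inner ℝ ((f • V) y) (W y)) = fun y ↦ f y * inner ℝ (V y) (W y) := by
      funext y; simp [inner_smul_left]
    have h2 : (fun y ↦ inner ℝ ((f • V) y) (S y)) = fun y ↦ f y * inner ℝ (V y) (S y) := by
      funext y; simp [inner_smul_left]
    simp only [koszul]
    rw [h1, h2, mvfderiv_fun_mul hf (mdifferentiableAt_inner hV hW), mvfderiv_fun_mul hf (mdifferentiableAt_inner hV hS),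
      mlieBracket_smul_left hf hV, mlieBracket_smul_left hf hV]
    simp [inner_add_left, inner_smul_left, inner_smul_right]
    ring
  add {V V'} hV hV' := by
    have h1 : (fun y ↦ inner ℝ ((V + V') y) (W y))
        = fun y ↦ inner ℝ (V y) (W y) + inner ℝ (V' y) (W y) := by
      funext y; simp [inner_add_left]
    have h2 : (fun y ↦ inner ℝ ((V + V') y) (S y))
        = fun y ↦ inner ℝ (V y) (S y) + inner ℝ (V' y) (S y) := by
      funext y; simp [inner_add_left]
    simp only [koszul]
    rw [h1, h2, mvfderiv_fun_add (mdifferentiableAt_inner hV hW) (mdifferentiableAt_inner hV' hW),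
      mvfderiv_fun_add (mdifferentiableAt_inner hV hS) (mdifferentiableAt_inner hV' hS),
      mlieBracket_add_left hV hV', mlieBracket_add_left hV hV']
    simp [inner_add_left, inner_add_right]
    ring

theorem koszul_tensorial_right {S V : Π x : M, TangentSpace I x} {x : M}
    (hS : MDiffAt (T% S) x) (hV : MDiffAt (T% V) x) :
    TensorialAt I E (fun W ↦ koszul I S V W x) x where
  smul {f W} hf hW := by
    have h1 : (fun y ↦ inner ℝ (S y) ((f • W) y)) = fun y ↦ f y * inner ℝ (S y) (W y) := by
      funext y; simp [inner_smul_right]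
    have h2 : (fun y ↦ inner ℝ (V y) ((f • W) y)) = fun y ↦ f y * inner ℝ (V y) (W y) := by
      funext y; simp [inner_smul_right]
    simp only [koszul]
    rw [h1, h2, mvfderiv_fun_mul hf (mdifferentiableAt_inner hS hW), mvfderiv_fun_mul hf (mdifferentiableAt_inner hV hW),
      mlieBracket_smul_right hf hW, mlieBracket_smul_right hf hW]
    simp [inner_add_left, inner_smul_left, inner_smul_right]
    rw [real_inner_comm (V x) (W x), real_inner_comm (S x) (W x)]
    ring
  add {W W'} hW hW' := by
    have h1 : (fun y ↦ inner ℝ (S y) ((W + W') y))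
        = fun y ↦ inner ℝ (S y) (W y) + inner ℝ (S y) (W' y) := by
      funext y; simp [inner_add_right]
    have h2 : (fun y ↦ inner ℝ (V y) ((W + W') y))
        = fun y ↦ inner ℝ (V y) (W y) + inner ℝ (V y) (W' y) := by
      funext y; simp [inner_add_right]
    simp only [koszul]
    rw [h1, h2, mvfderiv_fun_add (mdifferentiableAt_inner hS hW) (mdifferentiableAt_inner hS hW'),
      mvfderiv_fun_add (mdifferentiableAt_inner hV hW) (mdifferentiableAt_inner hV hW'),
      mlieBracket_add_right hW hW', mlieBracket_add_right hW hW']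
    simp [inner_add_left, inner_add_right]
    ring

instance instFiniteDimensionalTangent (x : M) : FiniteDimensional ℝ (TangentSpace I x) :=
  inferInstanceAs (FiniteDimensional ℝ E)

instance instCompleteTangent (x : M) : CompleteSpace (TangentSpace I x) :=
  FiniteDimensional.complete ℝ (TangentSpace I x)

/-- For a vector field `S` differentiable at `x`, the bilinear form `(v, w) ↦ ⟨∇_v S, w⟩` on
`T_x M` given by the Koszul formula. -/
def koszulForm (S : Π x : M, TangentSpace I x) (x : M) (hS : MDiffAt (T% S) x) :
    TangentSpace I x →L[ℝ] TangentSpace I x →L[ℝ] ℝ :=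
  TensorialAt.mkHom₂ (fun V W ↦ koszul I S V W x) x
    (fun _ hW ↦ koszul_tensorial_left hS hW) (fun _ hV ↦ koszul_tensorial_right hS hV)

open Classical in
/-- The Levi-Civita covariant derivative, as a bare function: `leviCivitaFun S x v = ∇_v S`. The
vector `∇_v S` is determined by its inner products, which the Koszul formula prescribes. The value
`0` is a default for vector fields that are not differentiable at `x`. -/
def leviCivitaFun (S : Π x : M, TangentSpace I x) (x : M) :
    TangentSpace I x →L[ℝ] TangentSpace I x :=
  if hS : MDiffAt (T% S) x then
    LinearMap.toContinuousLinearMap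
      { toFun v := (InnerProductSpace.toDual ℝ (TangentSpace I x)).symm (koszulForm S x hS v)
        map_add' v w := by simp
        map_smul' c v := by simp }
  else 0

theorem inner_leviCivitaFun {S V W : Π x : M, TangentSpace I x} {x : M}
    (hS : MDiffAt (T% S) x) (hV : MDiffAt (T% V) x) (hW : MDiffAt (T% W) x) :
    inner ℝ (leviCivitaFun S x (V x)) (W x) = koszul I S V W x := by
  simp only [leviCivitaFun, hS, dif_pos]
  change inner ℝ ((InnerProductSpace.toDual ℝ (TangentSpace I x)).symm
    (koszulForm S x hS (V x))) (W x) = _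
  rw [InnerProductSpace.toDual_symm_apply]
  exact TensorialAt.mkHom₂_apply _ _ hV hW

theorem ext_koszul {x : M} {A B : TangentSpace I x →L[ℝ] TangentSpace I x}
    (h : ∀ V W : Π x : M, TangentSpace I x, MDiffAt (T% V) x → MDiffAt (T% W) x →
      inner ℝ (A (V x)) (W x) = (inner ℝ (B (V x)) (W x) : ℝ)) : A = B := by
  ext v
  refine ext_inner_right ℝ fun w ↦ ?_
  have := h (FiberBundle.extend E v) (FiberBundle.extend E w)
    (FiberBundle.mdifferentiableAt_extend ..) (FiberBundle.mdifferentiableAt_extend ..)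
  simpa using this

theorem isCovariantDerivativeOn_leviCivitaFun :
    IsCovariantDerivativeOn E
      (leviCivitaFun : (Π x : M, TangentSpace I x) → _) Set.univ where
  add {S S'} x hS hS' _ := by
    refine ext_koszul fun V W hV hW ↦ ?_
    have hSS : MDiffAt (T% (S + S')) x := mdifferentiableAt_add_section hS hS'
    rw [inner_leviCivitaFun hSS hV hW, _root_.add_apply, inner_add_left,
      inner_leviCivitaFun hS hV hW, inner_leviCivitaFun hS' hV hW]
    have h1 : (fun y ↦ inner ℝ ((S + S') y) (W y))
        = fun y ↦ inner ℝ (S y) (W y) + inner ℝ (S' y) (W y) := by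
      funext y; simp [inner_add_left]
    have h2 : (fun y ↦ inner ℝ (V y) ((S + S') y))
        = fun y ↦ inner ℝ (V y) (S y) + inner ℝ (V y) (S' y) := by
      funext y; simp [inner_add_right]
    simp only [koszul]
    rw [h1, h2, mvfderiv_fun_add (mdifferentiableAt_inner hS hW) (mdifferentiableAt_inner hS' hW),
      mvfderiv_fun_add (mdifferentiableAt_inner hV hS) (mdifferentiableAt_inner hV hS'),
      mlieBracket_add_left hS hS', mlieBracket_add_right hS hS']
    simp [inner_add_left, inner_add_right]
    ring
  leibniz {S f} x hS hf _ := by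
    refine ext_koszul fun V W hV hW ↦ ?_
    have hfS : MDiffAt (T% (f • S)) x := hf.smul_section hS
    rw [inner_leviCivitaFun hfS hV hW, _root_.add_apply, inner_add_left,
      _root_.smul_apply, inner_smul_left, inner_leviCivitaFun hS hV hW]
    have h1 : (fun y ↦ inner ℝ ((f • S) y) (W y)) = fun y ↦ f y * inner ℝ (S y) (W y) := by
      funext y; simp [inner_smul_left]
    have h2 : (fun y ↦ inner ℝ (V y) ((f • S) y)) = fun y ↦ f y * inner ℝ (V y) (S y) := by
      funext y; simp [inner_smul_right]
    simp only [koszul]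
    rw [h1, h2, mvfderiv_fun_mul hf (mdifferentiableAt_inner hS hW),
      mvfderiv_fun_mul hf (mdifferentiableAt_inner hV hS),
      mlieBracket_smul_left hf hS, mlieBracket_smul_right hf hS]
    simp [inner_add_left, inner_smul_left, inner_smul_right]
    rw [real_inner_comm (V x) (S x)]
    ring

variable (I M) in
/-- The Levi-Civita connection of a Riemannian manifold. -/
def leviCivita : CovariantDerivative I E (TangentSpace I : M → Type _) where
  toFun := leviCivitaFun
  isCovariantDerivativeOnUniv := isCovariantDerivativeOn_leviCivitaFun

/-- The Levi-Civita connection is torsion-free. -/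
theorem torsion_leviCivita : (leviCivita I M).torsion = 0 := by
  rw [CovariantDerivative.torsion_eq_zero_iff]
  intro X Y x hX hY
  refine ext_inner_right ℝ fun w ↦ ?_
  have hW := FiberBundle.mdifferentiableAt_extend I E w
  have h1 := inner_leviCivitaFun hY hX hW
  have h2 := inner_leviCivitaFun hX hY hW
  simp only [FiberBundle.extend_apply_self] at h1 h2
  change inner ℝ (leviCivitaFun Y x (X x) - leviCivitaFun X x (Y x)) w = _
  rw [inner_sub_left, h1, h2]
  have hc : (fun y ↦ (inner ℝ (X y) (Y y) : ℝ)) = fun y ↦ inner ℝ (Y y) (X y) := by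
    funext y; rw [real_inner_comm]
  simp only [koszul]
  rw [hc, mlieBracket_swap_apply (V := Y) (W := X)]
  simp [inner_neg_left]
  ring

/-- The Levi-Civita connection is compatible with the metric:
`X⟨S, T⟩ = ⟨∇_X S, T⟩ + ⟨S, ∇_X T⟩`. -/
theorem metric_leviCivita {X S T : Π x : M, TangentSpace I x} {x : M}
    (hX : MDiffAt (T% X) x) (hS : MDiffAt (T% S) x) (hT : MDiffAt (T% T) x) :
    mvfderiv I (fun y ↦ (inner ℝ (S y) (T y) : ℝ)) x (X x)
      = inner ℝ (leviCivita I M S x (X x)) (T x)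
        + inner ℝ (S x) (leviCivita I M T x (X x)) := by
  have h1 := inner_leviCivitaFun hS hX hT
  have h2 := inner_leviCivitaFun hT hX hS
  change _ = inner ℝ (leviCivitaFun S x (X x)) (T x) + inner ℝ (S x) (leviCivitaFun T x (X x))
  rw [real_inner_comm _ (S x), h1, h2]
  have hc : (fun y ↦ (inner ℝ (T y) (S y) : ℝ)) = fun y ↦ inner ℝ (S y) (T y) := by
    funext y; rw [real_inner_comm]
  simp only [koszul]
  rw [hc, mlieBracket_swap_apply (V := T) (W := S)]
  simp [inner_neg_left]
  ring

variable (I)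

/-- The gradient `∇u`: `⟨∇u(x), v⟩ = du_x(v)`. -/
def grad (u : M → ℝ) (x : M) : TangentSpace I x :=
  (InnerProductSpace.toDual ℝ (TangentSpace I x)).symm (mvfderiv I u x)

/-- The Hessian `∇du` as a bilinear form: `(∇du)(v, w) = ⟨∇_v ∇u, w⟩`. -/
def hess (u : M → ℝ) (x : M) (v w : TangentSpace I x) : ℝ :=
  inner ℝ (leviCivita I M (grad I u) x v) w

/-- The squared norm `|∇du|²` at `x`, computed in an orthonormal basis of `T_x M`. -/
def hessNormSq (u : M → ℝ) (x : M) : ℝ :=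
  ∑ i, ∑ j, hess I u x (stdOrthonormalBasis ℝ (TangentSpace I x) i)
    (stdOrthonormalBasis ℝ (TangentSpace I x) j) ^ 2

/-- The divergence of a vector field: the trace of `v ↦ ∇_v S`. -/
def divergence (S : Π x : M, TangentSpace I x) (x : M) : ℝ :=
  LinearMap.trace ℝ (TangentSpace I x) (leviCivita I M S x).toLinearMap

/-- The `p`-Laplacian `div(|∇u|^(p-2) ∇u)`. -/
def pLaplacian (p : ℝ) (u : M → ℝ) : M → ℝ :=
  divergence I fun y ↦ ‖grad I u y‖ ^ (p - 2) • grad I u y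

/-- A `C²` function `u` is `p`-harmonic: `div(|∇u|^(p-2) ∇u) = 0`. The equation is imposed at the
points where `du ≠ 0`; there the field `|∇u|^(p-2) ∇u` is differentiable. At critical points it need
not be differentiable if `p < 2`, the equation holds automatically if `p > 2`, and it follows from
the equation elsewhere by continuity if `p = 2`. -/
def IsPHarmonic (p : ℝ) (u : M → ℝ) : Prop :=
  ∀ x : M, mvfderiv I u x ≠ 0 → pLaplacian I p u x = 0

end General

end RiemKato

end

/-!
The claim is pointwise. At a point where `∇u ≠ 0`, let `e` be an orthonormal basis with
`∇u = |∇u| e₁` and let `uᵢⱼ` be the components of the Hessian. Metric compatibility gives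
`d|∇u|(v) = (∇du)(v, e₁)` (`mvfderiv_norm_grad`), so that `|∇|∇u||² = ∑ⱼ uⱼ₁²`, while the Leibniz
rule turns the `p`-Laplace equation into the trace condition `∑ᵢ uᵢᵢ + (p - 2) u₁₁ = 0`
(`pLaplacian_eq`). The Hessian is symmetric (`hess_symm`), because the Levi-Civita connection is
torsion-free. What is left is linear algebra: the difference of the two sides of the inequality is
`(1 - κ) ∑ₐ u₁ₐ² + ∑_{a ≠ b} u_{ab}² + ∑ₐ (uₐₐ + (p - 1) / (m - 1) u₁₁)²
  + ((p - 1)² / (m - 1) - κ) u₁₁²`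
with indices `a, b ≥ 2` (`sum_sq_sub_eq`). Each term is nonnegative by the choice of `κ`, and
equality means that all of them vanish (`sum_sq_eq_iff_cases`).

All of this presupposes that `∇u` is differentiable when `u` is `C²` (`mdifferentiableAt_grad`): in
a local frame its coefficients solve a linear system with differentiable coefficients, whose matrix
is the Gram matrix of the frame.
-/

namespace RiemKato

/-! ### Functions and systems of linear equations on a manifold -/

section Manifold

variable {E : Type*} [NormedAddCommGroup E] [NormedSpace ℝ E]
  {H : Type*} [TopologicalSpace H] {I : ModelWithCorners ℝ E H}
  {M : Type*} [TopologicalSpace M] [ChartedSpace H M]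

/-- The function `du(V)` is obtained by composing `V` with the tangent map of `u`, which is `C¹`. -/
theorem mdifferentiableAt_mvfderiv_apply [IsManifold I ∞ M] {u : M → ℝ}
    (hu : ContMDiff I 𝓘(ℝ, ℝ) 2 u)
    {V : Π x : M, TangentSpace I x} {x : M} (hV : MDiffAt (T% V) x) :
    MDiffAt (fun y ↦ mvfderiv I u y (V y)) x := by
  have h1 : ContMDiff I.tangent 𝓘(ℝ, ℝ).tangent 1 (tangentMap I 𝓘(ℝ, ℝ) u) :=
    hu.contMDiff_tangentMap (by norm_num [one_add_one_eq_two])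
  have h2 := (h1.mdifferentiableAt one_ne_zero (x := (⟨x, V x⟩ : TangentBundle I M))).comp x hV
  have h3 := ((mdifferentiableAt_totalSpace _ _).1 h2).2
  simpa using! h3

/-- In the chart at `x`, with `f` the coordinate expression of `u`, differentiating `u` along the
vector field with constant coordinates `w` is differentiating `f` in the direction `w`. -/
theorem exists_fderiv_chart [I.Boundaryless] [IsManifold I ∞ M] {u : M → ℝ}
    (hu : ContMDiff I 𝓘(ℝ, ℝ) 2 u) (x : M) :
    ∃ f : E → ℝ, ContDiffAt ℝ 2 f (extChartAt I x x) ∧ ∀ᶠ y in nhds x, ∀ w : E,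
      mvfderiv I u y (mpullback I 𝓘(ℝ, E) (extChartAt I x) (fun _ ↦ w) y)
        = fderiv ℝ f (extChartAt I x y) w := by
  have hf : ContMDiffOn 𝓘(ℝ, E) 𝓘(ℝ, ℝ) 2 (u ∘ (extChartAt I x).symm) (extChartAt I x).target :=
    hu.comp_contMDiffOn (((contMDiffOn_extChartAt_symm (n := ∞) x)).of_le (by norm_cast))
  refine ⟨u ∘ (extChartAt I x).symm, ?_, ?_⟩
  · exact (contMDiffOn_iff_contDiffOn.1 hf).contDiffAt (extChartAt_target_mem_nhds x)
  · filter_upwards [extChartAt_source_mem_nhds (I := I) x] with y hy w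
    have ht : (extChartAt I x).target ∈ nhds (extChartAt I x y) :=
      extChartAt_target_mem_nhds' ((extChartAt I x).map_source hy)
    have hd : MDifferentiableAt 𝓘(ℝ, E) 𝓘(ℝ, ℝ) (u ∘ (extChartAt I x).symm) (extChartAt I x y) :=
      (hf.contMDiffAt ht).mdifferentiableAt two_ne_zero
    have hφ : MDifferentiableAt I 𝓘(ℝ, E) (extChartAt I x) y :=
      mdifferentiableAt_extChartAt (by simpa using hy)
    have hc : u =ᶠ[nhds y] (u ∘ (extChartAt I x).symm) ∘ extChartAt I x := by
      filter_upwards [extChartAt_source_mem_nhds' (I := I) hy] with z hz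
      exact congrArg u ((extChartAt I x).left_inv hz).symm
    have hinv := isInvertible_mfderiv_extChartAt hy
    have h1 : mvfderiv I u y = mvfderiv I ((u ∘ (extChartAt I x).symm) ∘ extChartAt I x) y := by
      have := hc.mfderiv_eq (I := I) (I' := 𝓘(ℝ, ℝ))
      unfold mvfderiv
      ext v
      simpa using! congr($this v)
    have h2 : mfderiv I 𝓘(ℝ, E) (extChartAt I x) y
        (mpullback I 𝓘(ℝ, E) (extChartAt I x) (fun _ ↦ w) y) = w :=
      hinv.self_apply_inverse w
    rw [h1, mvfderiv_comp_apply y hd hφ]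
    refine (congrArg _ h2).trans ?_
    simp [mvfderiv, mfderiv_eq_fderiv]
    rfl

theorem mdifferentiableAt_det {n : ℕ}
    {A : M → Matrix (Fin n) (Fin n) ℝ} {x : M} (hA : ∀ i j, MDiffAt (fun y ↦ A y i j) x) :
    MDiffAt (fun y ↦ (A y).det) x := by
  simp only [Matrix.det_apply']
  have := MDifferentiableAt.sum (I := I) (z := x) (t := Finset.univ)
    (f := fun (σ : Equiv.Perm (Fin n)) y ↦ ((Equiv.Perm.sign σ : ℤ) : ℝ) * ∏ i, A y (σ i) i) ?_
  · simpa [Finset.sum_fn] using! this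
  · intro σ _
    refine mdifferentiableAt_const.mul ?_
    simpa [Finset.prod_fn] using! MDifferentiableAt.prod (I := I) (z := x) (t := Finset.univ)
      (f := fun i y ↦ A y (σ i) i) fun i _ ↦ hA (σ i) i

/-- The solution of a linear system with differentiable coefficients is differentiable, by Cramer's
rule. -/
theorem mdifferentiableAt_of_mulVec_eq {n : ℕ}
    {G : M → Matrix (Fin n) (Fin n) ℝ} {c r : M → Fin n → ℝ} {x : M}
    (hG : ∀ i j, MDiffAt (fun y ↦ G y i j) x)
    (hr : ∀ i, MDiffAt (fun y ↦ r y i) x) (hdet : ∀ᶠ y in nhds x, (G y).det ≠ 0)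
    (h : ∀ᶠ y in nhds x, (G y).mulVec (c y) = r y) (i : Fin n) :
    MDiffAt (fun y ↦ c y i) x := by
  have h1 : MDiffAt (fun y ↦ ((G y).det)⁻¹) x :=
    (differentiableAt_inv hdet.self_of_nhds).mdifferentiableAt.comp x (mdifferentiableAt_det hG)
  have h2 : MDiffAt (fun y ↦ (G y).cramer (r y) i) x := by
    simp only [Matrix.cramer_apply]
    refine mdifferentiableAt_det fun a b ↦ ?_
    by_cases hb : b = i
    · subst hb
      simpa using hr a
    · simpa [hb] using hG a b
  refine (h1.mul h2).congr_of_eventuallyEq ?_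
  filter_upwards [hdet, h] with y hy hy'
  have h3 : (G y).cramer (r y) i = (G y).det * c y i := by
    rw [← hy', Matrix.cramer_eq_adjugate_mulVec, Matrix.mulVec_mulVec, Matrix.adjugate_mul,
      Matrix.smul_mulVec, Matrix.one_mulVec, Pi.smul_apply, smul_eq_mul]
  simp [h3, inv_mul_cancel_left₀ hy]

end Manifold

/-! ### Gradient and Hessian -/

section Riemannian

variable {E : Type*} [NormedAddCommGroup E] [NormedSpace ℝ E]
  {H : Type*} [TopologicalSpace H] {I : ModelWithCorners ℝ E H}
  {M : Type*} [TopologicalSpace M] [ChartedSpace H M]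
  [RiemannianBundle (fun (x : M) ↦ TangentSpace I x)]
  [FiniteDimensional ℝ E] [IsManifold I ∞ M]
  [IsContMDiffRiemannianBundle I ∞ E (fun (x : M) ↦ TangentSpace I x)]

omit [IsManifold I ∞ M] [IsContMDiffRiemannianBundle I ∞ E (fun (x : M) ↦ TangentSpace I x)] in
theorem inner_grad (u : M → ℝ) (x : M) (v : TangentSpace I x) :
    inner ℝ (grad I u x) v = mvfderiv I u x v := by
  rw [grad, InnerProductSpace.toDual_symm_apply]

omit [FiniteDimensional ℝ E] in
theorem mlieBracket_const (a b x : E) :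
    mlieBracket 𝓘(ℝ, E) (fun z : E ↦ (a : TangentSpace 𝓘(ℝ, E) z)) (fun _ ↦ b) x = 0 := by
  have h1 := congr_fun (mlieBracketWithin_univ (I := 𝓘(ℝ, E)) (V := fun _ : E ↦ a)
    (W := fun _ ↦ b)) x
  have h2 := congr_fun (mlieBracketWithin_eq_lieBracketWithin (𝕜 := ℝ) (V := fun _ : E ↦ a)
    (W := fun _ ↦ b) (s := Set.univ)) x
  refine h1.symm.trans (h2.trans ?_)
  simp [lieBracketWithin]
  rfl

/-- The coefficients of `∇u` in a local frame solve the linear system given by the Gram matrix of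
the frame and the functions `du(sᵢ)`. -/
theorem mdifferentiableAt_grad {u : M → ℝ} (hu : ContMDiff I 𝓘(ℝ, ℝ) 2 u) (x : M) :
    MDiffAt (T% (grad I u)) x := by
  set e := trivializationAt E (TangentSpace I : M → Type _) x
  set b := Module.finBasis ℝ E
  have hx : x ∈ e.baseSet := mem_baseSet_trivializationAt E _ x
  have hs (i) : MDiffAt (T% (e.localFrame b i)) x :=
    (contMDiffAt_localFrame_of_mem (I := I) 1 e b i hx).mdifferentiableAt one_ne_zero
  have hnhds := e.open_baseSet.mem_nhds hx
  rw [mdifferentiableAt_iff_localFrameCoeff b hx]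
  refine mdifferentiableAt_of_mulVec_eq
    (G := fun y ↦ Matrix.gram ℝ fun i ↦ e.localFrame b i y)
    (c := fun y i ↦ e.localFrameCoeff I b i y (grad I u y))
    (r := fun y i ↦ mvfderiv I u y (e.localFrame b i y)) ?_ ?_ ?_ ?_
  · intro i j
    exact mdifferentiableAt_inner (hs i) (hs j)
  · exact fun i ↦ mdifferentiableAt_mvfderiv_apply hu (hs i)
  · filter_upwards [hnhds] with y hy
    refine (Matrix.posDef_gram_of_linearIndependent ?_).det_pos.ne'
    exact (e.isLocalFrameOn_localFrame_baseSet I 1 b).linearIndependent hy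
  · filter_upwards [hnhds] with y hy
    ext i
    rw [← inner_grad, real_inner_comm]
    conv_rhs => rw [e.eq_sum_localFrameCoeff_smul (I := I) (b := b) (s := grad I u) hy]
    rw [inner_sum]
    simp [Matrix.mulVec, dotProduct, Matrix.gram_apply, inner_smul_right, mul_comm]

/-- Test the Hessian on vector fields with constant coordinates in a chart. They commute, so that
by vanishing torsion the Christoffel terms agree, and what remains is the second derivative of the
coordinate expression of `u`. -/
theorem hess_symm [I.Boundaryless] {u : M → ℝ} (hu : ContMDiff I 𝓘(ℝ, ℝ) 2 u) (x : M)
    (v w : TangentSpace I x) :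
    hess I u x v w = hess I u x w v := by
  obtain ⟨f, hf, hfu⟩ := exists_fderiv_chart hu x
  have hinv := isInvertible_mfderiv_extChartAt (I := I) (mem_extChartAt_source (I := I) x)
  -- the vector field whose coordinates in the chart at `x` are constantly `a`
  let X (a : E) : Π y : M, TangentSpace I y := mpullback I 𝓘(ℝ, E) (extChartAt I x) (fun _ ↦ a)
  let D : TangentSpace I x →L[ℝ] E := mfderiv I 𝓘(ℝ, E) (extChartAt I x) x
  have hXD (v : TangentSpace I x) : X (D v) x = v := hinv.inverse_apply_self v
  have hDX (a : E) : D (X a x) = a := hinv.self_apply_inverse a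
  have hconst (a : E) :
      MDiffAt (fun z : E ↦ (⟨z, a⟩ : TangentBundle 𝓘(ℝ, E) E)) (extChartAt I x x) :=
    (contMDiffAt_vectorSpace_iff_contDiffAt (V := fun _ : E ↦ a).2
      (contDiffAt_const (n := 1))).mdifferentiableAt one_ne_zero
  have h2 : (2 : WithTop ℕ∞) ≤ ∞ := by norm_cast
  have hX (a : E) : MDiffAt (T% (X a)) x :=
    (hconst a).mpullback_vectorField (contMDiffAt_extChartAt (n := ∞)) hinv h2
  have hbr (a b : E) : mlieBracket I (X a) (X b) x = 0 := by
    have : IsManifold I (minSmoothness ℝ 2) M := by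
      simpa using IsManifold.of_le (n := ∞) h2
    have hφ : ContMDiffAt I 𝓘(ℝ, E) ∞ (extChartAt I x) x := contMDiffAt_extChartAt
    rw [← mpullback_mlieBracket (hconst a) (hconst b) hφ (by simpa using h2), mpullback_apply]
    exact (congrArg _ (mlieBracket_const a b _)).trans (map_zero _)
  have key (a b : E) : hess I u x (X a x) (X b x) = fderiv ℝ (fderiv ℝ f) (extChartAt I x x) a b
      - mvfderiv I u x (leviCivita I M (X b) x (X a x)) := by
    have h1 := metric_leviCivita (hX a) (mdifferentiableAt_grad hu x) (hX b)
    rw [inner_grad u x] at h1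
    rw [hess, ← sub_eq_of_eq_add h1]
    congr 1
    have hd : (fun y ↦ inner ℝ (grad I u y) (X b y)) =ᶠ[nhds x]
        (fun z ↦ fderiv ℝ f z b) ∘ extChartAt I x := by
      filter_upwards [hfu] with y hy
      rw [inner_grad]
      exact hy b
    have hf' : DifferentiableAt ℝ (fderiv ℝ f) (extChartAt I x x) :=
      (hf.fderiv_right (m := 1) (by norm_num [one_add_one_eq_two])).differentiableAt one_ne_zero
    have hfb := hf'.clm_apply (differentiableAt_const b)
    have h3 : mvfderiv I (fun y ↦ inner ℝ (grad I u y) (X b y)) x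
        = mvfderiv I ((fun z ↦ fderiv ℝ f z b) ∘ extChartAt I x) x := by
      ext v
      simpa [mvfderiv] using! congr($(hd.mfderiv_eq (I := I) (I' := 𝓘(ℝ, ℝ))) v)
    rw [h3, mvfderiv_comp_apply x hfb.mdifferentiableAt
      (mdifferentiableAt_extChartAt (ChartedSpace.mem_chart_source x))]
    refine (congrArg _ (hDX a)).trans ?_
    simp only [mvfderiv, mfderiv_eq_fderiv]
    change fderiv ℝ (fun z ↦ fderiv ℝ f z b) (extChartAt I x x) a = _
    rw [fderiv_clm_apply hf' (differentiableAt_const b)]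
    simp
  have htor := (CovariantDerivative.torsion_eq_zero_iff _).1 (torsion_leviCivita (I := I) (M := M))
    (hX (D v)) (hX (D w))
  have h1 := key (D v) (D w)
  have h2 := key (D w) (D v)
  have h3 := (hf.isSymmSndFDerivAt (by simp)) (D v) (D w)
  rw [hbr, sub_eq_zero, hXD, hXD] at htor
  rw [hXD, hXD] at h1 h2
  rw [h1, h2, h3, htor]

theorem mdifferentiableAt_norm_grad {u : M → ℝ} (hu : ContMDiff I 𝓘(ℝ, ℝ) 2 u) {x : M}
    (hx : grad I u x ≠ 0) : MDiffAt (fun y ↦ ‖grad I u y‖) x := by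
  have h := mdifferentiableAt_inner (mdifferentiableAt_grad hu x) (mdifferentiableAt_grad hu x)
  have h0 : inner ℝ (grad I u x) (grad I u x) ≠ 0 := inner_self_ne_zero.2 hx
  simp only [norm_eq_sqrt_real_inner]
  exact (Real.hasDerivAt_sqrt h0).differentiableAt.mdifferentiableAt.comp x h

/-- Metric compatibility applied to `|∇u|² = ⟨∇u, ∇u⟩`. -/
theorem norm_grad_mul_mvfderiv {u : M → ℝ} (hu : ContMDiff I 𝓘(ℝ, ℝ) 2 u) {x : M}
    (hx : grad I u x ≠ 0) (v : TangentSpace I x) :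
    ‖grad I u x‖ * mvfderiv I (fun y ↦ ‖grad I u y‖) x v = hess I u x v (grad I u x) := by
  have hN := mdifferentiableAt_norm_grad hu hx
  have h1 := metric_leviCivita (FiberBundle.mdifferentiableAt_extend I E v)
    (mdifferentiableAt_grad hu x) (mdifferentiableAt_grad hu x)
  simp only [FiberBundle.extend_apply_self] at h1
  have h2 : (fun y ↦ inner ℝ (grad I u y) (grad I u y))
      = fun y ↦ ‖grad I u y‖ * ‖grad I u y‖ := by
    funext y; exact real_inner_self_eq_norm_mul_norm _
  rw [h2, mvfderiv_fun_mul hN hN, real_inner_comm] at h1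
  simp at h1
  rw [hess, real_inner_comm]
  linarith

omit [IsManifold I ∞ M] in
theorem grad_ne_zero {u : M → ℝ} {x : M} (hx : mvfderiv I u x ≠ 0) : grad I u x ≠ 0 := by
  simpa [grad] using hx

/-! ### Coordinates in an orthonormal basis -/

section Basis

variable {ι : Type*} [Fintype ι] {u : M → ℝ} {x : M}

/-- The Hilbert–Schmidt norm of `A` does not depend on the orthonormal basis. -/
theorem sum_sq_inner_eq_trace {V : Type*} [NormedAddCommGroup V] [InnerProductSpace ℝ V]
    [FiniteDimensional ℝ V] (A : V →L[ℝ] V) (e : OrthonormalBasis ι ℝ V) :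
    ∑ i, ∑ j, inner ℝ (A (e i)) (e j) ^ 2
      = LinearMap.trace ℝ V (ContinuousLinearMap.adjoint A ∘L A).toLinearMap := by
  rw [LinearMap.trace_eq_sum_inner _ e]
  refine Finset.sum_congr rfl fun i _ ↦ ?_
  have := e.sum_sq_norm_inner_left (A (e i))
  simp [ContinuousLinearMap.adjoint_inner_right] at this ⊢
  rw [this]

theorem hessNormSq_eq (e : OrthonormalBasis ι ℝ (TangentSpace I x)) :
    hessNormSq I u x = ∑ i, ∑ j, hess I u x (e i) (e j) ^ 2 := by
  simp only [hessNormSq, hess]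
  rw [sum_sq_inner_eq_trace, sum_sq_inner_eq_trace]

theorem mvfderiv_norm_grad (hu : ContMDiff I 𝓘(ℝ, ℝ) 2 u) (hx : grad I u x ≠ 0)
    {n : TangentSpace I x} (hn : grad I u x = ‖grad I u x‖ • n) (v : TangentSpace I x) :
    mvfderiv I (fun y ↦ ‖grad I u y‖) x v = hess I u x v n := by
  have h := norm_grad_mul_mvfderiv hu hx v
  have h2 : hess I u x v (grad I u x) = ‖grad I u x‖ * hess I u x v n := by
    conv_lhs => rw [hn]
    rw [hess, inner_smul_right, hess]
  rw [h2] at h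
  exact mul_left_cancel₀ (norm_ne_zero_iff.2 hx) h

theorem norm_grad_norm_grad_sq (hu : ContMDiff I 𝓘(ℝ, ℝ) 2 u) (hx : grad I u x ≠ 0)
    (e : OrthonormalBasis ι ℝ (TangentSpace I x)) {i₁ : ι}
    (hn : grad I u x = ‖grad I u x‖ • e i₁) :
    ‖grad I (fun y ↦ ‖grad I u y‖) x‖ ^ 2 = ∑ j, hess I u x (e j) (e i₁) ^ 2 := by
  rw [← e.sum_sq_norm_inner_left]
  refine Finset.sum_congr rfl fun j _ ↦ ?_
  rw [inner_grad, mvfderiv_norm_grad hu hx hn]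
  simp

/-- With `∇u = |∇u| e₁`, the `p`-Laplacian is `|∇u|^(p-2) (Δu + (p - 2) u₁₁)`. -/
theorem pLaplacian_eq (p : ℝ) (hu : ContMDiff I 𝓘(ℝ, ℝ) 2 u) (hx : grad I u x ≠ 0)
    (e : OrthonormalBasis ι ℝ (TangentSpace I x)) {i₁ : ι}
    (hn : grad I u x = ‖grad I u x‖ • e i₁) :
    pLaplacian I p u x = ‖grad I u x‖ ^ (p - 2) *
      (∑ i, hess I u x (e i) (e i) + (p - 2) * hess I u x (e i₁) (e i₁)) := by
  have hN := mdifferentiableAt_norm_grad hu hx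
  have hpos : 0 < ‖grad I u x‖ := norm_pos_iff.2 hx
  have hrpow := Real.hasDerivAt_rpow_const (p := p - 2) (Or.inl hpos.ne')
  have hf : MDiffAt (fun y ↦ ‖grad I u y‖ ^ (p - 2)) x :=
    hrpow.differentiableAt.mdifferentiableAt.comp x hN
  have hdf (v) : mvfderiv I (fun y ↦ ‖grad I u y‖ ^ (p - 2)) x v
      = (p - 2) * ‖grad I u x‖ ^ (p - 2 - 1) * hess I u x v (e i₁) := by
    rw [← mvfderiv_norm_grad hu hx hn]
    have := mvfderiv_comp_apply x hrpow.differentiableAt.mdifferentiableAt hN v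
    refine this.trans ?_
    simp only [mvfderiv, mfderiv_eq_fderiv]
    change fderiv ℝ (fun t : ℝ ↦ t ^ (p - 2)) ‖grad I u x‖ _ = _
    rw [hrpow.hasFDerivAt.fderiv]
    exact mul_comm _ _
  have hL := (leviCivita I M).isCovariantDerivativeOnUniv.leibniz
    (mdifferentiableAt_grad hu x) hf
  have hdiv : pLaplacian I p u x = LinearMap.trace ℝ (TangentSpace I x)
    (leviCivita I M ((fun y ↦ ‖grad I u y‖ ^ (p - 2)) • grad I u) x).toLinearMap := rfl
  have hterm (i) : inner ℝ (e i)
      (leviCivita I M ((fun y ↦ ‖grad I u y‖ ^ (p - 2)) • grad I u) x (e i))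
      = ‖grad I u x‖ ^ (p - 2) * hess I u x (e i) (e i)
        + (p - 2) * ‖grad I u x‖ ^ (p - 2 - 1) * hess I u x (e i) (e i₁)
          * inner ℝ (e i) (grad I u x) := by
    rw [← hdf, hess, real_inner_comm]
    have := congr(inner ℝ ($hL (e i)) (e i))
    refine this.trans ?_
    simp [inner_add_left, inner_smul_left, real_inner_comm]
  have hpow : ‖grad I u x‖ ^ (p - 2 - 1) * ‖grad I u x‖ = ‖grad I u x‖ ^ (p - 2) := by
    rw [← Real.rpow_add_one hpos.ne']; ring_nf
  have hinner (j) (hj : j ≠ i₁) : inner ℝ (e j) (grad I u x) = 0 := by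
    rw [hn, inner_smul_right, e.inner_eq_zero hj, mul_zero]
  have hinner₁ : inner ℝ (e i₁) (grad I u x) = ‖grad I u x‖ := by
    nth_rw 1 [hn]
    simp [inner_smul_right]
  have hsum : ∑ j, (p - 2) * ‖grad I u x‖ ^ (p - 2 - 1) * hess I u x (e j) (e i₁)
        * inner ℝ (e j) (grad I u x)
      = (p - 2) * ‖grad I u x‖ ^ (p - 2 - 1) * hess I u x (e i₁) (e i₁) * ‖grad I u x‖ := by
    rw [Finset.sum_eq_single i₁ (fun j _ hj ↦ by rw [hinner j hj, mul_zero]) (by simp), hinner₁]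
  rw [hdiv, LinearMap.trace_eq_sum_inner _ e]
  simp only [ContinuousLinearMap.coe_coe, hterm, Finset.sum_add_distrib, ← Finset.mul_sum]
  rw [hsum, ← hpow]
  ring

end Basis

end Riemannian

/-! ### The algebraic inequality -/

section Algebra

variable {ι : Type*} [Fintype ι] [DecidableEq ι] {h : ι → ι → ℝ} {i₁ : ι} {p : ℝ}

/-- The defect in the refined Kato inequality, for a symmetric matrix `h` subject to the pointwise
`p`-Laplace equation. All four summands are nonnegative once `κ ≤ 1` and `κ ≤ (p - 1)² / c`. The
third is the equality defect of Cauchy–Schwarz for the diagonal entries `h a a`, `a ≠ i₁`, whose sum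
is `-(p - 1) h i₁ i₁`. -/
theorem sum_sq_sub_eq (hsymm : ∀ i j, h i j = h j i)
    (htr : ∑ i, h i i + (p - 2) * h i₁ i₁ = 0) {c : ℝ} (hc : c = Fintype.card ι - 1)
    (hc0 : c ≠ 0) (κ : ℝ) :
    ∑ i, ∑ j, h i j ^ 2 - (1 + κ) * ∑ j, h j i₁ ^ 2 =
      (1 - κ) * ∑ a ∈ Finset.univ.erase i₁, h i₁ a ^ 2
      + ∑ a ∈ Finset.univ.erase i₁, ∑ b ∈ (Finset.univ.erase i₁).erase a, h a b ^ 2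
      + ∑ a ∈ Finset.univ.erase i₁, (h a a + (p - 1) / c * h i₁ i₁) ^ 2
      + ((p - 1) ^ 2 / c - κ) * h i₁ i₁ ^ 2 := by
  set S := Finset.univ.erase i₁ with hS
  have split (f : ι → ℝ) : ∑ i, f i = f i₁ + ∑ a ∈ S, f a :=
    (Finset.add_sum_erase _ _ (Finset.mem_univ i₁)).symm
  have hcard : (S.card : ℝ) = c := by
    rw [hS, Finset.card_erase_of_mem (Finset.mem_univ _), Finset.card_univ, hc,
      Nat.cast_sub (Fintype.card_pos_iff.2 ⟨i₁⟩)]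
    simp
  have hrow (a) (ha : a ∈ S) :
      ∑ j, h a j ^ 2 = h i₁ a ^ 2 + (h a a ^ 2 + ∑ b ∈ S.erase a, h a b ^ 2) := by
    rw [split, hsymm a i₁, Finset.add_sum_erase _ (fun b ↦ h a b ^ 2) ha]
  have htr' : ∑ a ∈ S, h a a = -(p - 1) * h i₁ i₁ := by
    rw [split] at htr; linarith
  have hsq : ∑ a ∈ S, (h a a + (p - 1) / c * h i₁ i₁) ^ 2
      = ∑ a ∈ S, h a a ^ 2 - (p - 1) ^ 2 / c * h i₁ i₁ ^ 2 := by
    have expand (a) : (h a a + (p - 1) / c * h i₁ i₁) ^ 2 = h a a ^ 2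
        + 2 * ((p - 1) / c * h i₁ i₁) * h a a + ((p - 1) / c * h i₁ i₁) ^ 2 := by ring
    simp only [expand, Finset.sum_add_distrib, ← Finset.mul_sum, htr', Finset.sum_const,
      nsmul_eq_mul, hcard]
    field_simp
    ring
  rw [hsq, split, split, Finset.sum_congr rfl hrow, split fun j ↦ h j i₁ ^ 2]
  simp only [Finset.sum_add_distrib, fun a ↦ hsymm a i₁]
  ring

theorem le_sum_sq (hsymm : ∀ i j, h i j = h j i)
    (htr : ∑ i, h i i + (p - 2) * h i₁ i₁ = 0) {c : ℝ} (hc : c = Fintype.card ι - 1)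
    (hc0 : 0 < c) {κ : ℝ} (hκ : κ = min ((p - 1) ^ 2 / c) 1) :
    (1 + κ) * ∑ j, h j i₁ ^ 2 ≤ ∑ i, ∑ j, h i j ^ 2 := by
  have h1 : 0 ≤ 1 - κ := by rw [hκ]; linarith [min_le_right ((p - 1) ^ 2 / c) 1]
  have h2 : 0 ≤ (p - 1) ^ 2 / c - κ := by rw [hκ]; linarith [min_le_left ((p - 1) ^ 2 / c) 1]
  rw [← sub_nonneg, sum_sq_sub_eq hsymm htr hc hc0.ne']
  positivity

theorem sum_sq_eq_iff (hsymm : ∀ i j, h i j = h j i)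
    (htr : ∑ i, h i i + (p - 2) * h i₁ i₁ = 0) {c : ℝ} (hc : c = Fintype.card ι - 1)
    (hc0 : 0 < c) {κ : ℝ} (hκ : κ = min ((p - 1) ^ 2 / c) 1) :
    ∑ i, ∑ j, h i j ^ 2 = (1 + κ) * ∑ j, h j i₁ ^ 2 ↔
      (∀ a, a ≠ i₁ → (1 - κ) * h i₁ a ^ 2 = 0) ∧
      (∀ a b, a ≠ i₁ → b ≠ i₁ → a ≠ b → h a b = 0) ∧
      (∀ a, a ≠ i₁ → h a a + (p - 1) / c * h i₁ i₁ = 0) ∧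
      ((p - 1) ^ 2 / c - κ) * h i₁ i₁ ^ 2 = 0 := by
  have h1 : 0 ≤ 1 - κ := by rw [hκ]; linarith [min_le_right ((p - 1) ^ 2 / c) 1]
  have h2 : 0 ≤ (p - 1) ^ 2 / c - κ := by rw [hκ]; linarith [min_le_left ((p - 1) ^ 2 / c) 1]
  rw [← sub_eq_zero, sum_sq_sub_eq hsymm htr hc hc0.ne', add_eq_zero_iff_of_nonneg (by positivity)
    (by positivity), add_eq_zero_iff_of_nonneg (by positivity) (by positivity),
    add_eq_zero_iff_of_nonneg (by positivity) (by positivity), Finset.mul_sum,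
    Finset.sum_eq_zero_iff_of_nonneg (fun _ _ ↦ by positivity),
    Finset.sum_eq_zero_iff_of_nonneg (fun _ _ ↦ by positivity),
    Finset.sum_eq_zero_iff_of_nonneg (fun _ _ ↦ by positivity), and_assoc, and_assoc]
  refine and_congr (by simp) (and_congr ?_ (and_congr (by simp) Iff.rfl))
  constructor
  · intro H a b ha hb hab
    have := (Finset.sum_eq_zero_iff_of_nonneg (fun _ _ ↦ by positivity)).1 (H a (by simp [ha])) b
      (by simp [hb, hab.symm])
    simpa using this
  · intro H a ha
    refine Finset.sum_eq_zero fun b hb ↦ ?_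
    simp only [Finset.mem_erase, Finset.mem_univ, and_true] at ha hb
    rw [H a b ha hb.2 hb.1.symm, sq, mul_zero]

/-- The three regimes correspond to which of the coefficients `1 - κ` and `(p - 1)² / c - κ` in
`sum_sq_sub_eq` vanish: both if `(p - 1)² = c`, only the second if `(p - 1)² < c`, and only the
first if `(p - 1)² > c`. -/
theorem sum_sq_eq_iff_cases (hp : 1 < p) (hsymm : ∀ i j, h i j = h j i)
    (htr : ∑ i, h i i + (p - 2) * h i₁ i₁ = 0) {c : ℝ} (hc : c = Fintype.card ι - 1)
    (hc0 : 0 < c) {κ : ℝ} (hκ : κ = min ((p - 1) ^ 2 / c) 1) :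
    ∑ i, ∑ j, h i j ^ 2 = (1 + κ) * ∑ j, h j i₁ ^ 2 ↔
      ((p - 1) ^ 2 = c →
        (∀ α β, α ≠ i₁ → β ≠ i₁ → α ≠ β → h α β = 0) ∧
        (∀ α, α ≠ i₁ → h i₁ i₁ = -(c / (p - 1)) * h α α)) ∧
      ((p - 1) ^ 2 < c →
        (∀ α β, α ≠ i₁ → β ≠ i₁ → α ≠ β → h α β = 0) ∧
        (∀ α, α ≠ i₁ → h i₁ α = 0) ∧
        (∀ α, α ≠ i₁ → h i₁ i₁ = -(c / (p - 1)) * h α α)) ∧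
      ((p - 1) ^ 2 > c →
        (∀ α β, α ≠ i₁ → β ≠ i₁ → α ≠ β → h α β = 0) ∧ (∀ i, h i i = 0)) := by
  have hp' : p - 1 ≠ 0 := by linarith
  rw [sum_sq_eq_iff hsymm htr hc hc0 hκ]
  have hdiag (a) : h a a + (p - 1) / c * h i₁ i₁ = 0 ↔ h i₁ i₁ = -(c / (p - 1)) * h a a := by
    constructor
    · intro H
      rw [eq_neg_of_add_eq_zero_left H]
      field_simp
    · intro H
      rw [H]
      field_simp
      ring
  simp only [hdiag]
  rcases lt_trichotomy ((p - 1) ^ 2) c with hlt | heq | hgt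
  · have hq : (p - 1) ^ 2 / c < 1 := (div_lt_one hc0).2 hlt
    rw [min_eq_left hq.le] at hκ
    have h1 : 1 - κ ≠ 0 := by linarith
    simp only [hlt, hlt.ne, hlt.not_gt, hκ, sub_self, zero_mul, and_true, true_implies,
      false_implies, true_and]
    rw [hκ] at h1
    simp only [mul_eq_zero, h1, false_or, pow_eq_zero_iff two_ne_zero]
    tauto
  · have hq : (p - 1) ^ 2 / c = 1 := by rw [heq, div_self hc0.ne']
    rw [hq, min_self] at hκ
    simp [hκ, heq, hc0.ne']
  · have hq : 1 < (p - 1) ^ 2 / c := (one_lt_div hc0).2 hgt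
    rw [min_eq_right hq.le] at hκ
    have h1 : (p - 1) ^ 2 / c - 1 ≠ 0 := by linarith
    simp only [hgt, hgt.ne', hgt.not_gt, hκ, sub_self, zero_mul, true_implies, implies_true,
      false_implies, true_and, mul_eq_zero, h1, false_or, pow_eq_zero_iff two_ne_zero]
    refine and_congr_right fun _ ↦ ⟨fun ⟨H, H0⟩ i ↦ ?_, fun H ↦ ⟨fun a _ ↦ by simp [H], H i₁⟩⟩
    by_cases hi : i = i₁
    · rw [hi, H0]
    · have := (hdiag i).2 (H i hi)
      simpa [H0] using this

end Algebra

end RiemKato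


open RiemKato in
theorem mainTheorem5 (m : ℕ) (hm : 2 ≤ m)
    {M : Type*} [TopologicalSpace M] [ChartedSpace (EuclideanSpace ℝ (Fin m)) M]
    [IsManifold (𝓡 m) ∞ M]
    [RiemannianBundle (fun (x : M) ↦ TangentSpace (𝓡 m) x)]
    [IsContMDiffRiemannianBundle (𝓡 m) ∞ (EuclideanSpace ℝ (Fin m))
      (fun (x : M) ↦ TangentSpace (𝓡 m) x)]
    (p : ℝ) (hp : 1 < p) (κ : ℝ) (hκ : κ = min ((p - 1) ^ 2 / ((m : ℝ) - 1)) 1)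
    (u : M → ℝ) (hu : ContMDiff (𝓡 m) 𝓘(ℝ, ℝ) 2 u) (hpu : RiemKato.IsPHarmonic (𝓡 m) p u)
    (x : M) (hx : mvfderiv (𝓡 m) u x ≠ 0) :
    RiemKato.hessNormSq (𝓡 m) u x ≥
        (1 + κ) * ‖RiemKato.grad (𝓡 m) (fun y ↦ ‖RiemKato.grad (𝓡 m) u y‖) x‖ ^ 2 ∧
      ∀ (e : OrthonormalBasis (Fin m) ℝ (TangentSpace (𝓡 m) x)) (i₁ : Fin m),
        RiemKato.grad (𝓡 m) u x = ‖RiemKato.grad (𝓡 m) u x‖ • e i₁ →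
        (RiemKato.hessNormSq (𝓡 m) u x =
            (1 + κ) * ‖RiemKato.grad (𝓡 m) (fun y ↦ ‖RiemKato.grad (𝓡 m) u y‖) x‖ ^ 2 ↔
          ((p - 1) ^ 2 = (m : ℝ) - 1 →
            (∀ α β, α ≠ i₁ → β ≠ i₁ → α ≠ β → RiemKato.hess (𝓡 m) u x (e α) (e β) = 0) ∧
            (∀ α, α ≠ i₁ → RiemKato.hess (𝓡 m) u x (e i₁) (e i₁) =
              -(((m : ℝ) - 1) / (p - 1)) * RiemKato.hess (𝓡 m) u x (e α) (e α))) ∧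
          ((p - 1) ^ 2 < (m : ℝ) - 1 →
            (∀ α β, α ≠ i₁ → β ≠ i₁ → α ≠ β → RiemKato.hess (𝓡 m) u x (e α) (e β) = 0) ∧
            (∀ α, α ≠ i₁ → RiemKato.hess (𝓡 m) u x (e i₁) (e α) = 0) ∧
            (∀ α, α ≠ i₁ → RiemKato.hess (𝓡 m) u x (e i₁) (e i₁) =
              -(((m : ℝ) - 1) / (p - 1)) * RiemKato.hess (𝓡 m) u x (e α) (e α))) ∧
          ((p - 1) ^ 2 > (m : ℝ) - 1 →
            (∀ α β, α ≠ i₁ → β ≠ i₁ → α ≠ β → RiemKato.hess (𝓡 m) u x (e α) (e β) = 0) ∧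
            (∀ i, RiemKato.hess (𝓡 m) u x (e i) (e i) = 0))) := by
  have hg : grad (𝓡 m) u x ≠ 0 := grad_ne_zero hx
  have hc : (m : ℝ) - 1 = Fintype.card (Fin m) - 1 := by simp
  have hc0 : 0 < (m : ℝ) - 1 := by
    have : (2 : ℝ) ≤ m := by exact_mod_cast hm
    linarith
  have htr (e : OrthonormalBasis (Fin m) ℝ (TangentSpace (𝓡 m) x)) (i₁ : Fin m)
      (he : grad (𝓡 m) u x = ‖grad (𝓡 m) u x‖ • e i₁) :
      ∑ i, hess (𝓡 m) u x (e i) (e i) + (p - 2) * hess (𝓡 m) u x (e i₁) (e i₁) = 0 := by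
    have h := hpu x hx
    rw [pLaplacian_eq p hu hg e he] at h
    exact (mul_eq_zero.1 h).resolve_left (Real.rpow_pos_of_pos (norm_pos_iff.2 hg) _).ne'
  constructor
  · have i₁ : Fin m := ⟨0, by lia⟩
    obtain ⟨e, he⟩ : ∃ e : OrthonormalBasis (Fin m) ℝ (TangentSpace (𝓡 m) x),
        grad (𝓡 m) u x = ‖grad (𝓡 m) u x‖ • e i₁ := by
      have hfin : Module.finrank ℝ (TangentSpace (𝓡 m) x) = Fintype.card (Fin m) := by
        change Module.finrank ℝ (EuclideanSpace ℝ (Fin m)) = _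
        simp
      have hon : Orthonormal ℝ (({i₁} : Set (Fin m)).domRestrict
          fun _ ↦ ‖grad (𝓡 m) u x‖⁻¹ • grad (𝓡 m) u x) := by
        refine ⟨fun i ↦ ?_, fun i j hij ↦ (hij (Subsingleton.elim i j)).elim⟩
        simp [norm_smul, inv_mul_cancel₀ (norm_ne_zero_iff.2 hg)]
      obtain ⟨e, he⟩ := hon.exists_orthonormalBasis_extension_of_card_eq hfin
      refine ⟨e, ?_⟩
      rw [he i₁ rfl, smul_inv_smul₀ (norm_ne_zero_iff.2 hg)]
    rw [hessNormSq_eq e, norm_grad_norm_grad_sq hu hg e he]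
    exact le_sum_sq (fun i j ↦ hess_symm hu x _ _) (htr e i₁ he) hc hc0 hκ
  · intro e i₁ he
    rw [hessNormSq_eq e, norm_grad_norm_grad_sq hu hg e he]
    exact sum_sq_eq_iff_cases (h := fun i j ↦ hess (𝓡 m) u x (e i) (e j)) hp
      (fun i j ↦ hess_symm hu x _ _) (htr e i₁ he) hc hc0 hκ
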